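/- Let $n\ge 3$ and let $G=(V,E)$ be a simple graph with vertex set $V=[n]=\{1,2,\dots,n\}$. Let $\chi(G,x)$ be the chromatic polynomial of $G$, i.e. the polynomial such that $\chi(G,k)$ is the number of proper $k$-colourings of $G$ for every positive integer $k$. For $u,v\in V$ put $\delta_G(u,v)=1$ if $u<v$ or $uv\in E$, and $\delta_G(u,v)=0$ otherwise. For an ordering $\pi=(u_1,\dots,u_n)$ of the elements of $V$ put $\delta_G(\pi)=\sum_{i=1}^{n-1}\delta_G(u_i,u_{i+1})$, and define $$\Psi(G,x)=\sum_{\pi}\binom{x+\delta_G(\pi)}{n},$$ where the sum runs over all $n!$ orderings $\pi$ of $V$ and $\binom{y}{k}=y(y-1)\cdots(y-k+1)/k!$. Let $\mathcal W(G)$ be the set of $3$-element subsets $\{a,b,c\}$ of $V$ with $a<b<c$ such that $ac$ is the only edge of the subgraph of $G$ induced by $\{a,b,c\}$. Then there are non-negative integers $d_0,d_1,\dots,d_{n-3}$ such that, as polynomials in $x$, $$\Psi(G,x)=(-1)^n\chi(G,-x)+\sum_{i=0}^{n-3}d_i\binom{x+i}{n-2}.$$ Furthermore, $d_i=0$ for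 all $i=0,1,\dots,n-3$ if and only if $\mathcal W(G)=\emptyset$. -/

import Mathlib

open Polynomial

noncomputable section

namespace SimpleGraph

/-- Proper colourings are the same as a partition of the vertex set into independent classes
together with an injective assignment of colours to the classes. -/
def coloringEquivSigma {V : Type*} (G : SimpleGraph V) (α : Type*) :
    G.Coloring α ≃
      (Σ r : {r : Setoid V // ∀ u v, G.Adj u v → ¬ r u v}, (Quotient r.1 ↪ α)) where
  toFun c := ⟨⟨Setoid.ker c, fun _ _ h => c.valid h⟩,
    ⟨Setoid.kerLift c, Setoid.kerLift_injective c⟩⟩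
  invFun p := Coloring.mk (fun v => p.2 (Quotient.mk p.1.1 v))
    (fun {u v} h he => p.1.2 u v h (Quotient.exact (p.2.injective he)))
  left_inv c := by
    ext v
    rfl
  right_inv p := by
    obtain ⟨⟨r, hr⟩, f⟩ := p
    have key : ∀ (s : Setoid V) (hs : ∀ u v, G.Adj u v → ¬ s u v) (g : Quotient s ↪ α),
        s = r → (∀ v, g (Quotient.mk s v) = f (Quotient.mk r v)) →
        (⟨⟨s, hs⟩, g⟩ : Σ r : {r : Setoid V // ∀ u v, G.Adj u v → ¬ r u v},
          (Quotient r.1 ↪ α)) = ⟨⟨r, hr⟩, f⟩ := by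
      intro s hs g h
      subst h
      intro hg
      have : g = f := by
        ext q
        induction q using Quotient.inductionOn with
        | h v => exact hg v
      rw [this]
    apply key
    · ext u v
      exact ⟨fun h => Quotient.exact (f.injective h), fun h => congrArg f (Quotient.sound h)⟩
    · intro v
      rfl

/-- There is a polynomial whose value at every positive integer `k` is the number of proper
`k`-colourings of `G`. -/
theorem exists_chromaticPolynomial {V : Type*} [Finite V] (G : SimpleGraph V) :
    ∃ P : ℚ[X], ∀ k : ℕ, 0 < k → P.eval (k : ℚ) = (Nat.card (G.Coloring (Fin k)) : ℚ) := by
  classical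
  have : Finite (Setoid V) :=
    Finite.of_injective (fun r : Setoid V => (fun u v => r u v : V → V → Prop))
      (fun r s h => Setoid.ext fun u v => iff_of_eq (congrFun (congrFun h u) v))
  have := Fintype.ofFinite V
  have := Fintype.ofFinite {r : Setoid V // ∀ u v, G.Adj u v → ¬ r u v}
  refine ⟨∑ r : {r : Setoid V // ∀ u v, G.Adj u v → ¬ r u v},
    descPochhammer ℚ (Fintype.card (Quotient r.1)), fun k _ => ?_⟩
  rw [Nat.card_congr (G.coloringEquivSigma (Fin k)), Nat.card_eq_fintype_card,
    Fintype.card_sigma, eval_finsetSum, Nat.cast_sum]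
  refine Finset.sum_congr rfl fun r _ => ?_
  rw [Fintype.card_embedding_eq, Fintype.card_fin, descPochhammer_eval_eq_descFactorial]

/-- The chromatic polynomial of `G`: the polynomial whose value at every positive integer `k`
is the number of proper `k`-colourings of `G`. -/
def chromaticPolynomial {V : Type*} [Finite V] (G : SimpleGraph V) : ℚ[X] :=
  Classical.choose G.exists_chromaticPolynomial

/-- The defining property of the chromatic polynomial. -/
theorem chromaticPolynomial_eval {V : Type*} [Finite V] (G : SimpleGraph V) (k : ℕ)
    (hk : 0 < k) :
    G.chromaticPolynomial.eval (k : ℚ) = (Nat.card (G.Coloring (Fin k)) : ℚ) :=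
  Classical.choose_spec G.exists_chromaticPolynomial k hk

/-- The defining property determines the chromatic polynomial. -/
theorem eq_chromaticPolynomial {V : Type*} [Finite V] (G : SimpleGraph V) (P : ℚ[X])
    (hP : ∀ k : ℕ, 0 < k → P.eval (k : ℚ) = (Nat.card (G.Coloring (Fin k)) : ℚ)) :
    P = G.chromaticPolynomial := by
  refine Polynomial.eq_of_infinite_eval_eq _ _ (Set.Infinite.mono ?_
    (Set.infinite_range_of_injective
      (f := fun k : ℕ => ((k + 1 : ℕ) : ℚ)) fun a b h => by simpa using h))
  rintro _ ⟨k, rfl⟩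
  exact (hP (k + 1) k.succ_pos).trans (G.chromaticPolynomial_eval (k + 1) k.succ_pos).symm

open Classical in
/-- `δ_G(u, v) = 1` if `u < v` or `uv` is an edge, and `0` otherwise. -/
def orderDelta {n : ℕ} (G : SimpleGraph (Fin n)) (u v : Fin n) : ℕ :=
  if u < v ∨ G.Adj u v then 1 else 0

/-- `δ_G(π)`, the sum of `δ_G(u_i, u_{i+1})` over consecutive entries of the ordering
`π = (u_1, …, u_n)`; an ordering of the vertices is a bijection from positions to vertices. -/
def orderingDelta {n : ℕ} (G : SimpleGraph (Fin n)) (π : Equiv.Perm (Fin n)) : ℕ :=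
  ∑ i : Fin (n - 1),
    G.orderDelta (π ⟨(i : ℕ), by omega⟩) (π ⟨(i : ℕ) + 1, by omega⟩)

/-- `Ψ(G, x)`, the sum of the binomial coefficients `(x + δ_G(π) choose n)`, as polynomials
in `x`, over all `n!` orderings `π` of the vertices. -/
def psiPolynomial {n : ℕ} (G : SimpleGraph (Fin n)) : ℚ[X] :=
  ∑ π : Equiv.Perm (Fin n), Ring.choose (X + (G.orderingDelta π : ℚ[X])) n

/-- `W(G)`, the set of 3-element sets `{a, b, c}` of vertices with `a < b < c` such that `ac` is
the only edge of the subgraph of `G` induced by `{a, b, c}`. -/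
def singleLongEdgeTriples {n : ℕ} (G : SimpleGraph (Fin n)) : Set (Finset (Fin n)) :=
  {S | ∃ a b c : Fin n, a < b ∧ b < c ∧ S = {a, b, c} ∧
    G.Adj a c ∧ ¬ G.Adj a b ∧ ¬ G.Adj b c}

end SimpleGraph

end

/-!
Both sides are compared at negative integers. By reciprocity for binomial coefficients,
`(-1) ^ n * Ψ(G, -k)` counts the maps `f : V → [k]` such that vertices of the same colour which
are consecutive among the vertices of that colour are not adjacent, while `χ(G, k)` counts the
proper colourings. For set functions `L` (the indicator of the sets in which consecutive elements
are not adjacent) and `I` (the indicator of the independent sets), these are the values at `V` of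
the `k`-th powers of `L` and `I` for the convolution product over disjoint unions. Write `t` for
the variable of generating functions in `k`. Multiplying the generating functions by
`(1 - t) ^ (|S| + 1)` gives numerators `orderingSum` and `coloringNumerator`, which satisfy
`H = 1 + t • (Z * H)` for the same weight `Z` (nonempty independent sets `R` weighted by
`(1 - t) ^ (|R| - 1)`), except that `orderingSum` has the additional term
`t * (1 - t) ^ 2 • defectSum` (`orderingSum_eq`, `coloringNumerator_eq`). Hence the difference of
the numerators is `t * (1 - t) ^ 2` times `coloringNumerator * defectSum` (`orderingSum_sub`), and
`d i` is the `i`-th coefficient of that product.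

The term `defectSum` arises from cutting a run `u₁ > u₂ > ⋯` with consecutive vertices not adjacent
at the first vertex `c` that spoils independence: the run starts with an independent set `R ∪ {b}`
with minimum `b`, where `R` meets the neighbourhood of `c` and `b` does not, and goes on with `c`.
So `c < b < r` with `r ∈ R` adjacent to `c` is an element of `W(G)`, and there is no such run
if and only if `W(G) = ∅`. What follows `c` contributes `continuationSum`, which is visibly
non-negative. What comes from `R` and the proper colouring contributes a difference
`Z_B * H - Z_B' * H`, where `Z_U` is the restriction of `Z` to subsets of `U` and `B' ⊆ B`. That
`Z_U * H` is monotone in `U` follows by induction on the size of the set: adding one vertex `v`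
to `U` changes the value at `S` by the value at `S \ {v}` of
`1 + t • (Z * H - Z_W * H) + Z_W * H` with `W = U \ N(v)`
(`setConv_nonemptyIndepWeight_insert`, `setConv_nonemptyIndepWeight_mono`).
-/

open Polynomial

noncomputable section

namespace SimpleGraph

/-! ### The convolution algebra of set functions -/

section Convolution

variable {V A : Type*} [DecidableEq V] [CommRing A]

/-- The product of set functions coming from multiplication of square-free monomials: the value
at `S` sums over all ways to split `S` into an ordered pair of complementary subsets. -/
def setConv (f g : Finset V → A) (S : Finset V) : A :=
  ∑ T ∈ S.powerset, f T * g (S \ T)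

/-- The unit for `setConv`: the indicator of the empty set. -/
def setOne (S : Finset V) : A := if S = ∅ then 1 else 0

theorem setConv_comm (f g : Finset V → A) : setConv f g = setConv g f := by
  funext S
  refine Finset.sum_bij' (fun T _ => S \ T) (fun T _ => S \ T) ?_ ?_ ?_ ?_ ?_
  · intro T _; simp
  · intro T _; simp
  · intro T hT; simpa using Finset.mem_powerset.1 hT
  · intro T hT; simpa using Finset.mem_powerset.1 hT
  · intro T hT
    rw [Finset.sdiff_sdiff_eq_self (Finset.mem_powerset.1 hT), mul_comm]

theorem setConv_assoc (f g h : Finset V → A) :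
    setConv (setConv f g) h = setConv f (setConv g h) := by
  funext S
  simp only [setConv, Finset.sum_mul, Finset.mul_sum]
  rw [Finset.sum_sigma', Finset.sum_sigma']
  refine Finset.sum_bij' (fun p _ => ⟨p.2, p.1 \ p.2⟩) (fun p _ => ⟨p.1 ∪ p.2, p.1⟩) ?_ ?_ ?_ ?_ ?_
  · rintro ⟨T, U⟩ h
    simp only [Finset.mem_sigma, Finset.mem_powerset] at h ⊢
    exact ⟨h.2.trans h.1, Finset.sdiff_subset_sdiff h.1 subset_rfl⟩
  · rintro ⟨T, U⟩ h
    simp only [Finset.mem_sigma, Finset.mem_powerset] at h ⊢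
    exact ⟨Finset.union_subset h.1 (h.2.trans Finset.sdiff_subset), Finset.subset_union_left⟩
  · rintro ⟨T, U⟩ h
    simp only [Finset.mem_sigma, Finset.mem_powerset] at h ⊢
    rw [Finset.union_sdiff_of_subset h.2]
  · rintro ⟨T, U⟩ h
    simp only [Finset.mem_sigma, Finset.mem_powerset] at h ⊢
    rw [Finset.union_sdiff_cancel_left (Finset.disjoint_sdiff.mono_right h.2)]
  · rintro ⟨T, U⟩ h
    simp only [Finset.mem_sigma, Finset.mem_powerset] at h ⊢
    have : (S \ U) \ (T \ U) = S \ T := by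
      ext x
      have := @h.2 x
      simp only [Finset.mem_sdiff]
      tauto
    rw [this, mul_assoc]

theorem setConv_one (f : Finset V → A) : setConv f setOne = f := by
  funext S
  rw [setConv, Finset.sum_eq_single S]
  · simp [setOne]
  · intro T hT hne
    have : S \ T ≠ ∅ := fun h =>
      hne ((Finset.mem_powerset.1 hT).antisymm (Finset.sdiff_eq_empty_iff_subset.1 h))
    simp [setOne, this]
  · simp

theorem one_setConv (f : Finset V → A) : setConv setOne f = f := by
  rw [setConv_comm, setConv_one]

theorem add_setConv (f g h : Finset V → A) :
    setConv (f + g) h = setConv f h + setConv g h := by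
  funext S
  simp [setConv, add_mul, Finset.sum_add_distrib]

theorem sub_setConv (f g h : Finset V → A) :
    setConv (f - g) h = setConv f h - setConv g h := by
  funext S
  simp [setConv, sub_mul, Finset.sum_sub_distrib]

theorem smul_setConv (a : A) (f g : Finset V → A) :
    setConv (a • f) g = a • setConv f g := by
  funext S
  simp [setConv, Finset.mul_sum, mul_assoc]

theorem setConv_add (f g h : Finset V → A) :
    setConv f (g + h) = setConv f g + setConv f h := by
  rw [setConv_comm, add_setConv, setConv_comm g, setConv_comm h]

theorem setConv_smul (a : A) (f g : Finset V → A) :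
    setConv f (a • g) = a • setConv f g := by
  rw [setConv_comm, smul_setConv, setConv_comm g]

/-- The set function obtained from a family `g` by multiplying `g x` by the monomial `x` and
summing over `x`. -/
def sumErase (g : V → Finset V → A) (S : Finset V) : A := ∑ x ∈ S, g x (S.erase x)

theorem setConv_sumErase (f : Finset V → A) (g : V → Finset V → A) :
    setConv f (sumErase g) = sumErase fun x => setConv f (g x) := by
  funext S
  simp only [setConv, sumErase, Finset.mul_sum]
  rw [Finset.sum_sigma', Finset.sum_sigma']
  refine Finset.sum_bij' (fun p _ => ⟨p.2, p.1⟩) (fun p _ => ⟨p.2, p.1⟩) ?_ ?_ ?_ ?_ ?_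
  · rintro ⟨T, x⟩ h
    simp only [Finset.mem_sigma, Finset.mem_powerset, Finset.mem_sdiff,
      Finset.subset_erase] at h ⊢
    tauto
  · rintro ⟨x, T⟩ h
    simp only [Finset.mem_sigma, Finset.mem_powerset, Finset.mem_sdiff,
      Finset.subset_erase] at h ⊢
    tauto
  · rintro ⟨T, x⟩ h; rfl
  · rintro ⟨x, T⟩ h; rfl
  · rintro ⟨T, x⟩ h
    simp only [Finset.erase_sdiff_comm]

theorem sumErase_setConv (f : Finset V → A) (g : V → Finset V → A) :
    setConv (sumErase g) f = sumErase fun x => setConv (g x) f := by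
  rw [setConv_comm, setConv_sumErase]
  simp only [setConv_comm f]

theorem sumErase_comm (g : V → V → Finset V → A) :
    (sumErase fun x => sumErase fun y => g x y) = sumErase fun y => sumErase fun x => g x y := by
  funext S
  simp only [sumErase]
  rw [Finset.sum_sigma', Finset.sum_sigma']
  refine Finset.sum_bij' (fun p _ => ⟨p.2, p.1⟩) (fun p _ => ⟨p.2, p.1⟩) ?_ ?_ ?_ ?_ ?_
  · rintro ⟨x, y⟩ h
    simp only [Finset.mem_sigma, Finset.mem_erase] at h ⊢
    tauto
  · rintro ⟨x, y⟩ h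
    simp only [Finset.mem_sigma, Finset.mem_erase] at h ⊢
    tauto
  · rintro ⟨x, y⟩ h; rfl
  · rintro ⟨x, y⟩ h; rfl
  · rintro ⟨x, y⟩ h
    simp only [Finset.erase_right_comm]

theorem sumErase_add (g h : V → Finset V → A) :
    (sumErase fun x => g x + h x) = sumErase g + sumErase h := by
  funext S
  simp [sumErase, Finset.sum_add_distrib]

theorem sumErase_smul (a : A) (g : V → Finset V → A) :
    (sumErase fun x => a • g x) = a • sumErase g := by
  funext S
  simp [sumErase, Finset.mul_sum]

theorem zero_setConv (f : Finset V → A) :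
    setConv 0 f = 0 := by
  funext S
  simp [setConv]

theorem setConv_zero (f : Finset V → A) :
    setConv f 0 = 0 := by
  rw [setConv_comm, zero_setConv]

end Convolution

/-! ### Weighted independent sets -/

section IndependentSets

variable {n : ℕ} {A : Type*} [CommRing A] (t : A) (G : SimpleGraph (Fin n))

/-- The vertices `r` with `δ_G(r, x) = 0`, that is, the vertices `r ≥ x` not adjacent to `x`;
`x` itself is included. -/
def upperNonNeighbors (x : Fin n) : Set (Fin n) := {r | G.orderDelta r x = 0}

theorem mem_upperNonNeighbors {r x : Fin n} :
    r ∈ G.upperNonNeighbors x ↔ x ≤ r ∧ ¬ G.Adj r x := by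
  simp [upperNonNeighbors, orderDelta]

open Classical in
/-- Independent subsets `R` of `U`, with weight `(1 - t) ^ |R|`. -/
def indepWeight (U : Set (Fin n)) (R : Finset (Fin n)) : A :=
  if G.IsIndepSet (R : Set (Fin n)) ∧ (R : Set (Fin n)) ⊆ U then (1 - t) ^ R.card else 0

open Classical in
/-- Nonempty independent subsets `R` of `U`, with weight `(1 - t) ^ (|R| - 1)`. -/
def nonemptyIndepWeight (U : Set (Fin n)) (R : Finset (Fin n)) : A :=
  if R ≠ ∅ ∧ G.IsIndepSet (R : Set (Fin n)) ∧ (R : Set (Fin n)) ⊆ U then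
    (1 - t) ^ (R.card - 1) else 0

theorem indepWeight_eq (U : Set (Fin n)) :
    G.indepWeight t U = setOne + (1 - t) • G.nonemptyIndepWeight t U := by
  classical
  funext R
  by_cases hR : R = ∅
  · subst hR
    simp [indepWeight, nonemptyIndepWeight, setOne]
  · have hc : R.card - 1 + 1 = R.card := Nat.succ_pred (by simpa using hR)
    have h1 : setOne R = (0 : A) := if_neg hR
    rw [Pi.add_apply, Pi.smul_apply, h1, zero_add, smul_eq_mul]
    by_cases h : G.IsIndepSet (R : Set (Fin n)) ∧ (R : Set (Fin n)) ⊆ U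
    · rw [indepWeight, nonemptyIndepWeight, if_pos h, if_pos ⟨hR, h⟩, ← pow_succ', hc]
    · rw [indepWeight, nonemptyIndepWeight, if_neg h, if_neg fun h' => h h'.2, mul_zero]

theorem isIndepSet_erase_iff {R : Finset (Fin n)} {x : Fin n} (hx : x ∈ R) :
    G.IsIndepSet (R : Set (Fin n)) ↔
      G.IsIndepSet (R.erase x : Set (Fin n)) ∧ ∀ r ∈ R.erase x, ¬ G.Adj r x := by
  constructor
  · refine fun h => ⟨h.mono (by simp), fun r hr => ?_⟩
    exact h (Finset.mem_of_mem_erase hr) hx (Finset.ne_of_mem_erase hr)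
  · rintro ⟨h1, h2⟩ a ha b hb hab
    by_cases hax : a = x
    · subst hax
      rw [G.adj_comm]
      exact h2 b (Finset.mem_erase.2 ⟨hab.symm, hb⟩)
    · by_cases hbx : b = x
      · subst hbx
        exact h2 a (Finset.mem_erase.2 ⟨hab, ha⟩)
      · exact h1 (Finset.mem_coe.2 (Finset.mem_erase.2 ⟨hax, ha⟩))
          (Finset.mem_coe.2 (Finset.mem_erase.2 ⟨hbx, hb⟩)) hab

open Classical in
/-- Splitting off the smallest vertex of a nonempty independent set: the term of the sum at `x`
vanishes unless `x` is the minimum of the set. -/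
theorem nonemptyIndepWeight_eq_sumErase (U : Set (Fin n)) :
    G.nonemptyIndepWeight t U =
      sumErase fun x => if x ∈ U then G.indepWeight t (U ∩ G.upperNonNeighbors x) else 0 := by
  funext R
  by_cases hR : R = ∅
  · subst hR
    simp [nonemptyIndepWeight, sumErase]
  have hne := Finset.nonempty_iff_ne_empty.2 hR
  rw [sumErase, Finset.sum_eq_single (R.min' hne)]
  · have hm := R.min'_mem hne
    have hmin := R.min'_le
    set m := R.min' hne with hmdef
    have key : (R ≠ ∅ ∧ G.IsIndepSet (R : Set (Fin n)) ∧ (R : Set (Fin n)) ⊆ U) ↔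
        m ∈ U ∧ G.IsIndepSet (R.erase m : Set (Fin n)) ∧
          (R.erase m : Set (Fin n)) ⊆ U ∩ G.upperNonNeighbors m := by
      rw [G.isIndepSet_erase_iff hm]
      constructor
      · rintro ⟨-, ⟨h1, h2⟩, h3⟩
        refine ⟨h3 hm, h1, fun r hr => ?_⟩
        have hr' := Finset.mem_coe.1 hr
        have hrR := Finset.mem_of_mem_erase hr'
        exact ⟨h3 hrR, G.mem_upperNonNeighbors.2 ⟨hmin r hrR, h2 r hr'⟩⟩
      · rintro ⟨h0, h1, h2⟩
        refine ⟨hR, ⟨h1, fun r hr => ?_⟩, fun r hr => ?_⟩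
        · exact (G.mem_upperNonNeighbors.1 (h2 (Finset.mem_coe.2 hr)).2).2
        · by_cases h : r = m
          · rwa [h]
          · exact (h2 (Finset.mem_coe.2 (Finset.mem_erase.2 ⟨h, hr⟩))).1
    rw [nonemptyIndepWeight, if_congr key rfl rfl]
    by_cases hU : m ∈ U
    · rw [if_pos hU, indepWeight, Finset.card_erase_of_mem hm]
      exact if_congr (and_iff_right hU) rfl rfl
    · rw [if_neg hU, if_neg fun h => hU h.1, Pi.zero_apply]
  · intro x hx hxm
    split_ifs
    · rw [indepWeight, if_neg]
      rintro ⟨-, h⟩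
      have := (G.mem_upperNonNeighbors.1 (h (Finset.mem_coe.2
        (Finset.mem_erase.2 ⟨Ne.symm hxm, R.min'_mem hne⟩))).2).1
      exact hxm (this.antisymm (R.min'_le x hx))
    · rfl
  · intro h
    exact absurd (R.min'_mem hne) h

open Classical in
/-- Enlarging `U` by one vertex `v` adds the independent sets that contain `v`. -/
theorem nonemptyIndepWeight_insert (U : Set (Fin n)) {v : Fin n} (hv : v ∉ U) :
    G.nonemptyIndepWeight t (insert v U) = G.nonemptyIndepWeight t U +
      sumErase fun x => if x = v then G.indepWeight t (U \ G.neighborSet v) else 0 := by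
  funext R
  rw [Pi.add_apply]
  by_cases hR : v ∈ R
  · have h0 : R ≠ ∅ := Finset.ne_empty_of_mem hR
    have key : (R ≠ ∅ ∧ G.IsIndepSet (R : Set (Fin n)) ∧ (R : Set (Fin n)) ⊆ insert v U) ↔
        G.IsIndepSet (R.erase v : Set (Fin n)) ∧
          (R.erase v : Set (Fin n)) ⊆ U \ G.neighborSet v := by
      rw [and_iff_right h0, G.isIndepSet_erase_iff hR, and_assoc]
      refine and_congr_right fun _ => ⟨fun h r hr => ?_, fun h => ⟨fun r hr => ?_, fun r hr => ?_⟩⟩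
      · have hr' := Finset.mem_coe.1 hr
        refine ⟨(h.2 (Finset.mem_of_mem_erase hr')).resolve_left (Finset.ne_of_mem_erase hr'), ?_⟩
        rw [mem_neighborSet, G.adj_comm]
        exact h.1 r hr'
      · have := (h (Finset.mem_coe.2 hr)).2
        rwa [mem_neighborSet, G.adj_comm] at this
      · by_cases hrv : r = v
        · exact Or.inl hrv
        · exact Or.inr (h (Finset.mem_coe.2 (Finset.mem_erase.2 ⟨hrv, hr⟩))).1
    have hU : ¬ (R ≠ ∅ ∧ G.IsIndepSet (R : Set (Fin n)) ∧ (R : Set (Fin n)) ⊆ U) :=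
      fun h => hv (h.2.2 hR)
    rw [sumErase, Finset.sum_eq_single_of_mem v hR fun x _ hx => by rw [if_neg hx, Pi.zero_apply],
      if_pos rfl, nonemptyIndepWeight, nonemptyIndepWeight, if_congr key rfl rfl, if_neg hU,
      zero_add, indepWeight, Finset.card_erase_of_mem hR]
  · have h1 : (R : Set (Fin n)) ⊆ insert v U ↔ (R : Set (Fin n)) ⊆ U :=
      Set.subset_insert_iff_of_notMem (by simpa using hR)
    have h2 : ∀ x ∈ R, x ≠ v := fun x hx h => hR (h ▸ hx)
    rw [sumErase, Finset.sum_eq_zero fun x hx => by rw [if_neg (h2 x hx), Pi.zero_apply], add_zero,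
      nonemptyIndepWeight, nonemptyIndepWeight]
    exact if_congr (by rw [h1]) rfl rfl

end IndependentSets

/-! ### Orderings and the recursion they satisfy -/

section Words

variable {n : ℕ} {A : Type*} [CommRing A] (t : A) (G : SimpleGraph (Fin n))

/-- The sum of `t ^ δ_G(c, w₁, …, w_m)` over all sequences `w₁, …, w_m` of distinct elements
of `S`. -/
def wordSum : ℕ → Fin n → Finset (Fin n) → A
  | 0, _, _ => 1
  | m + 1, c, S => ∑ x ∈ S, t ^ G.orderDelta c x * wordSum m x (S.erase x)

/-- The sum of `t ^ δ_G(c, w)` over all orderings `w` of `S`. -/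
def continuationSum (c : Fin n) (S : Finset (Fin n)) : A := G.wordSum t S.card c S

/-- The sum of `t ^ (1 + δ_G(w))` over all orderings `w` of `S`, the empty ordering having
weight `1`. -/
def orderingSum : Finset (Fin n) → A := setOne + t • sumErase (G.continuationSum t)

theorem continuationSum_empty (c : Fin n) : G.continuationSum t c ∅ = 1 := rfl

theorem continuationSum_of_nonempty (c : Fin n) {S : Finset (Fin n)} (hS : S.Nonempty) :
    G.continuationSum t c S =
      ∑ x ∈ S, t ^ G.orderDelta c x * G.continuationSum t x (S.erase x) := by
  obtain ⟨m, hm⟩ := Nat.exists_eq_succ_of_ne_zero hS.card_pos.ne'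
  rw [continuationSum, hm, Nat.succ_eq_add_one, wordSum]
  refine Finset.sum_congr rfl fun x hx => ?_
  rw [continuationSum, Finset.card_erase_of_mem hx, hm, Nat.succ_eq_add_one, Nat.add_sub_cancel]

theorem orderDelta_eq_zero_or_one (u v : Fin n) : G.orderDelta u v = 0 ∨ G.orderDelta u v = 1 := by
  unfold orderDelta
  split_ifs <;> simp

open Classical in
/-- Steps of weight `t ^ 0` are split as `t + (1 - t)`: the summand `t` restarts the ordering, and
`1 - t` keeps the step. -/
theorem continuationSum_eq (c : Fin n) :
    G.continuationSum t c = G.orderingSum t +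
      (1 - t) • sumErase fun y => if c ∈ G.upperNonNeighbors y then G.continuationSum t y else 0 := by
  funext S
  rcases S.eq_empty_or_nonempty with rfl | hS
  · simp [continuationSum_empty, orderingSum, setOne, sumErase]
  · have h1 : setOne S = (0 : A) := if_neg hS.ne_empty
    rw [continuationSum_of_nonempty t G c hS, orderingSum]
    simp only [Pi.add_apply, Pi.smul_apply, h1, zero_add, sumErase, smul_eq_mul, Finset.mul_sum]
    rw [← Finset.sum_add_distrib]
    refine Finset.sum_congr rfl fun x _ => ?_
    rcases G.orderDelta_eq_zero_or_one c x with h | h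
    · rw [if_pos (show c ∈ G.upperNonNeighbors x from h), h]
      ring
    · have hc : c ∉ G.upperNonNeighbors x := fun h' => by
        rw [upperNonNeighbors, Set.mem_ofPred_eq, h] at h'
        exact one_ne_zero h'
      rw [if_neg hc, h, Pi.zero_apply]
      ring

open Classical in
/-- The sum over the pairs `b, c` with `δ_G(b, c) = 0` of the weights of all ways to take an
independent set of vertices above `b` and not adjacent to `b`, which meets the neighbourhood of
`c`, followed by `b`, by `c`, and by an arbitrary continuation. -/
def defectSum : Finset (Fin n) → A :=
  sumErase fun b => sumErase fun c => if b ∈ G.upperNonNeighbors c then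
    setConv (G.nonemptyIndepWeight t (G.upperNonNeighbors b) -
      G.nonemptyIndepWeight t (G.upperNonNeighbors b \ G.neighborSet c))
      (G.continuationSum t c) else 0

/-- Both `h1` and `h2` below expand the sum over all independent sets `R` followed by an ordering
that starts with the minimum of `R`. In `h1` the minimum is followed by a step of
`continuationSum_eq`; in `h2` the set `R` with its minimum `y` removed is empty or has a
minimum `x` of its own. The two double sums differ by the sets that the step makes dependent. -/
theorem sumErase_continuationSum_eq :
    sumErase (G.continuationSum t) =
      setConv (G.nonemptyIndepWeight t Set.univ) (G.orderingSum t) +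
        (1 - t) ^ 2 • G.defectSum t := by
  classical
  have h1 : (sumErase fun x =>
      setConv (G.indepWeight t (G.upperNonNeighbors x)) (G.continuationSum t x)) =
      setConv (G.nonemptyIndepWeight t Set.univ) (G.orderingSum t) +
      (1 - t) • sumErase fun b => sumErase fun c => if b ∈ G.upperNonNeighbors c then
        setConv (G.indepWeight t (G.upperNonNeighbors b)) (G.continuationSum t c) else 0 := by
    rw [nonemptyIndepWeight_eq_sumErase, sumErase_setConv, ← sumErase_smul, ← sumErase_add]
    congr 1
    funext x
    rw [continuationSum_eq, setConv_add, setConv_smul, setConv_sumErase, if_pos (Set.mem_univ x),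
      Set.univ_inter]
    congr 3
    funext y
    split_ifs
    · rfl
    · rw [setConv_zero]
  have h2 : (sumErase fun x =>
      setConv (G.indepWeight t (G.upperNonNeighbors x)) (G.continuationSum t x)) =
      sumErase (G.continuationSum t) +
      (1 - t) • sumErase fun b => sumErase fun c => if b ∈ G.upperNonNeighbors c then
        setConv (G.indepWeight t (G.upperNonNeighbors b \ G.neighborSet c))
          (G.continuationSum t c) else 0 := by
    rw [sumErase_comm, ← sumErase_smul, ← sumErase_add]
    congr 1
    funext y
    rw [indepWeight_eq, nonemptyIndepWeight_eq_sumErase, add_setConv, one_setConv, smul_setConv,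
      sumErase_setConv]
    congr 3
    funext x
    split_ifs with h
    · have : G.upperNonNeighbors y ∩ G.upperNonNeighbors x =
          G.upperNonNeighbors x \ G.neighborSet y := by
        ext r
        have h' := (G.mem_upperNonNeighbors.1 h).1
        simp only [Set.mem_inter_iff, Set.mem_sdiff, mem_upperNonNeighbors, mem_neighborSet,
          G.adj_comm y r]
        constructor
        · tauto
        · rintro ⟨⟨h3, h4⟩, h5⟩
          exact ⟨⟨h'.trans h3, h5⟩, h3, h4⟩
      rw [this]
    · rw [zero_setConv]
  have h3 : (sumErase fun b => sumErase fun c => if b ∈ G.upperNonNeighbors c then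
        setConv (G.indepWeight t (G.upperNonNeighbors b)) (G.continuationSum t c) else 0) =
      (sumErase fun b => sumErase fun c => if b ∈ G.upperNonNeighbors c then
        setConv (G.indepWeight t (G.upperNonNeighbors b \ G.neighborSet c))
          (G.continuationSum t c) else 0) + (1 - t) • G.defectSum t := by
    rw [defectSum, ← sumErase_smul, ← sumErase_add]
    congr 1
    funext b
    rw [← sumErase_smul, ← sumErase_add]
    congr 1
    funext c
    split_ifs
    · rw [← smul_setConv, ← add_setConv, indepWeight_eq, indepWeight_eq, smul_sub]
      congr 1
      abel
    · simp
  rw [h1, h3, smul_add, ← add_assoc, smul_smul, ← sq] at h2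
  exact (add_right_cancel ((add_right_comm _ _ _).trans h2)).symm

/-- The defect `defectSum` measures how far `orderingSum` is from satisfying the recursion that
characterises its analogue for proper colourings. -/
theorem orderingSum_eq :
    G.orderingSum t = setOne + t • setConv (G.nonemptyIndepWeight t Set.univ) (G.orderingSum t) +
      (t * (1 - t) ^ 2) • G.defectSum t := by
  conv_lhs => rw [orderingSum, sumErase_continuationSum_eq]
  rw [smul_add, smul_smul, add_assoc]

/-- Solving the two recursions for their difference. -/
theorem orderingSum_sub (h : Finset (Fin n) → A)
    (hh : h = setOne + t • setConv (G.nonemptyIndepWeight t Set.univ) h) :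
    G.orderingSum t - h = (t * (1 - t) ^ 2) • setConv h (G.defectSum t) := by
  set L := G.orderingSum t with hL
  set z := G.nonemptyIndepWeight t Set.univ with hz
  have h1 : setConv (h - t • setConv z h) L = L := by
    rw [sub_eq_of_eq_add hh, one_setConv]
  have h2 : setConv h (L - t • setConv z L) =
      h + (t * (1 - t) ^ 2) • setConv h (G.defectSum t) := by
    have : L - t • setConv z L = setOne + (t * (1 - t) ^ 2) • G.defectSum t := by
      rw [sub_eq_iff_eq_add]
      conv_lhs => rw [hL, orderingSum_eq]
      rw [← hL, ← hz]
      abel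
    rw [this, setConv_add, setConv_one, setConv_smul]
  have h3 : setConv (h - t • setConv z h) L = setConv h (L - t • setConv z L) := by
    have h4 : setConv h (L - t • setConv z L) = setConv h L - t • setConv h (setConv z L) := by
      rw [setConv_comm h, sub_setConv, smul_setConv, setConv_comm L, setConv_comm _ h]
    rw [h4, sub_setConv, smul_setConv, setConv_comm z h, setConv_assoc]
  rw [sub_eq_iff_eq_add', ← h2, ← h3, h1]

end Words

/-! ### Positivity of the difference -/

section Nonneg

/-- Power series with non-negative integer coefficients that are polynomials of degree at
most `d`. -/
def IsNonnegOfDegreeLE (d : ℕ) (p : PowerSeries ℤ) : Prop :=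
  ∀ i, 0 ≤ PowerSeries.coeff i p ∧ (d < i → PowerSeries.coeff i p = 0)

namespace IsNonnegOfDegreeLE

variable {d e : ℕ} {p q : PowerSeries ℤ}

theorem mono (hp : IsNonnegOfDegreeLE d p) (h : d ≤ e) : IsNonnegOfDegreeLE e p :=
  fun i => ⟨(hp i).1, fun hi => (hp i).2 (h.trans_lt hi)⟩

theorem zero : IsNonnegOfDegreeLE d 0 := fun i => by simp

theorem add (hp : IsNonnegOfDegreeLE d p) (hq : IsNonnegOfDegreeLE d q) :
    IsNonnegOfDegreeLE d (p + q) := fun i => by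
  rw [map_add]
  exact ⟨add_nonneg (hp i).1 (hq i).1, fun hi => by rw [(hp i).2 hi, (hq i).2 hi, add_zero]⟩

theorem sum {ι : Type*} {s : Finset ι} {f : ι → PowerSeries ℤ}
    (h : ∀ i ∈ s, IsNonnegOfDegreeLE d (f i)) : IsNonnegOfDegreeLE d (∑ i ∈ s, f i) :=
  Finset.sum_induction f _ (fun _ _ => add) zero h

theorem mul (hp : IsNonnegOfDegreeLE d p) (hq : IsNonnegOfDegreeLE e q) :
    IsNonnegOfDegreeLE (d + e) (p * q) := fun i => by
  rw [PowerSeries.coeff_mul]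
  refine ⟨Finset.sum_nonneg fun x _ => mul_nonneg (hp _).1 (hq _).1, fun hi =>
    Finset.sum_eq_zero fun x hx => ?_⟩
  have hx := Finset.HasAntidiagonal.mem_antidiagonal.1 hx
  rcases lt_or_ge d x.1 with h | h
  · rw [(hp _).2 h, zero_mul]
  · rw [(hq _).2 (by omega), mul_zero]

theorem one : IsNonnegOfDegreeLE d 1 := fun i => by
  rw [PowerSeries.coeff_one]
  split_ifs
  · exact ⟨zero_le_one, fun h => by omega⟩
  · exact ⟨le_rfl, fun _ => rfl⟩

theorem X : IsNonnegOfDegreeLE 1 PowerSeries.X := fun i => by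
  rw [PowerSeries.coeff_X]
  split_ifs
  · exact ⟨zero_le_one, fun h => by omega⟩
  · exact ⟨le_rfl, fun _ => rfl⟩

theorem X_pow (k : ℕ) : IsNonnegOfDegreeLE k (PowerSeries.X ^ k) := fun i => by
  rw [PowerSeries.coeff_X_pow]
  split_ifs
  · exact ⟨zero_le_one, fun h => by omega⟩
  · exact ⟨le_rfl, fun _ => rfl⟩

/-- There is no cancellation in a sum of power series with non-negative coefficients. -/
theorem sum_ne_zero {ι : Type*} {s : Finset ι} {f : ι → PowerSeries ℤ}
    (h : ∀ i ∈ s, IsNonnegOfDegreeLE d (f i)) {j : ι} (hj : j ∈ s) (hne : f j ≠ 0) :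
    ∑ i ∈ s, f i ≠ 0 := by
  intro h0
  refine hne (PowerSeries.ext fun k => ?_)
  have := congrArg (PowerSeries.coeff k) h0
  rw [map_sum, map_zero, Finset.sum_eq_zero_iff_of_nonneg fun i hi => (h i hi k).1] at this
  rw [this j hj, map_zero]

end IsNonnegOfDegreeLE

variable {n : ℕ} (G : SimpleGraph (Fin n))

theorem continuationSum_isNonneg (c : Fin n) (S : Finset (Fin n)) :
    IsNonnegOfDegreeLE S.card (G.continuationSum PowerSeries.X c S) := by
  induction hm : S.card generalizing c S with
  | zero =>
    rw [Finset.card_eq_zero.1 hm, continuationSum_empty]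
    exact .one
  | succ m ih =>
    rw [continuationSum_of_nonempty _ _ _ (Finset.card_pos.1 (by omega))]
    refine .sum fun x hx => ?_
    have h1 := ih x (S.erase x) (by rw [Finset.card_erase_of_mem hx]; omega)
    refine ((IsNonnegOfDegreeLE.X_pow _).mul h1).mono ?_
    rcases G.orderDelta_eq_zero_or_one c x with h | h <;> omega

theorem continuationSum_ne_zero (c : Fin n) (S : Finset (Fin n)) :
    G.continuationSum (PowerSeries.X : PowerSeries ℤ) c S ≠ 0 := by
  induction hm : S.card generalizing c S with
  | zero =>
    rw [Finset.card_eq_zero.1 hm, continuationSum_empty]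
    exact one_ne_zero
  | succ m ih =>
    have hS : S.Nonempty := Finset.card_pos.1 (by omega)
    rw [continuationSum_of_nonempty _ _ _ hS]
    obtain ⟨x, hx⟩ := hS
    refine IsNonnegOfDegreeLE.sum_ne_zero (d := 1 + n) (fun y _ => ?_) hx
      (mul_ne_zero (pow_ne_zero _ PowerSeries.X_ne_zero) (ih x _ ?_))
    · refine ((IsNonnegOfDegreeLE.X_pow _).mul (G.continuationSum_isNonneg y _)).mono ?_
      have : (S.erase y).card ≤ n := (Finset.card_le_univ _).trans_eq (Fintype.card_fin n)
      rcases G.orderDelta_eq_zero_or_one c y with h | h <;> omega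
    · rw [Finset.card_erase_of_mem hx, hm, Nat.add_sub_cancel]

theorem nonemptyIndepWeight_empty_left {A : Type*} [CommRing A] (t : A) :
    G.nonemptyIndepWeight t ∅ = 0 := by
  classical
  funext R
  rw [nonemptyIndepWeight, if_neg, Pi.zero_apply]
  rintro ⟨h1, -, h2⟩
  exact h1 (by simpa using h2)

theorem setConv_nonemptyIndepWeight_empty {A : Type*} [CommRing A] (t : A) (U : Set (Fin n))
    (h : Finset (Fin n) → A) : setConv (G.nonemptyIndepWeight t U) h ∅ = 0 := by
  simp [setConv, nonemptyIndepWeight]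

/-- The effect of adding one vertex to `U`. The right-hand side involves only smaller sets, and
its signs make the induction for `setConv_nonemptyIndepWeight_mono` work. -/
theorem setConv_nonemptyIndepWeight_insert {A : Type*} [CommRing A] (t : A)
    {h : Finset (Fin n) → A}
    (hh : h = setOne + t • setConv (G.nonemptyIndepWeight t Set.univ) h)
    {U : Set (Fin n)} {v : Fin n} (hv : v ∉ U) {S : Finset (Fin n)} (hS : v ∈ S) :
    setConv (G.nonemptyIndepWeight t (insert v U)) h S -
      setConv (G.nonemptyIndepWeight t U) h S =
    setOne (S.erase v) +
      t * (setConv (G.nonemptyIndepWeight t Set.univ) h (S.erase v) -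
        setConv (G.nonemptyIndepWeight t (U \ G.neighborSet v)) h (S.erase v)) +
      setConv (G.nonemptyIndepWeight t (U \ G.neighborSet v)) h (S.erase v) := by
  classical
  rw [nonemptyIndepWeight_insert t G U hv, add_setConv, Pi.add_apply, add_sub_cancel_left,
    sumErase_setConv, sumErase, Finset.sum_eq_single_of_mem v hS fun x _ hx => by
      rw [if_neg hx, zero_setConv, Pi.zero_apply],
    if_pos rfl, indepWeight_eq, add_setConv, one_setConv, smul_setConv]
  conv_lhs => rw [Pi.add_apply]; enter [1]; rw [hh]
  simp only [Pi.add_apply, Pi.smul_apply, smul_eq_mul]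
  ring

theorem setConv_nonemptyIndepWeight_insert_of_notMem {A : Type*} [CommRing A] (t : A)
    (h : Finset (Fin n) → A) (U : Set (Fin n)) {v : Fin n} {S : Finset (Fin n)} (hS : v ∉ S) :
    setConv (G.nonemptyIndepWeight t (insert v U)) h S =
      setConv (G.nonemptyIndepWeight t U) h S := by
  classical
  by_cases hv : v ∈ U
  · rw [Set.insert_eq_of_mem hv]
  have h1 : ∀ x ∈ S, x ≠ v := fun x hx hxv => hS (hxv ▸ hx)
  rw [nonemptyIndepWeight_insert t G U hv, add_setConv, Pi.add_apply, sumErase_setConv, sumErase,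
    Finset.sum_eq_zero fun x hx => by rw [if_neg (h1 x hx), zero_setConv, Pi.zero_apply], add_zero]

/-- The key positivity: if `h` is the numerator for proper colourings, the numerator for those
proper colourings whose first class is a nonempty subset of `U` is monotone in `U`. -/
theorem setConv_nonemptyIndepWeight_mono {h : Finset (Fin n) → PowerSeries ℤ}
    (hh : h = setOne + (PowerSeries.X : PowerSeries ℤ) •
      setConv (G.nonemptyIndepWeight PowerSeries.X Set.univ) h)
    {U U' : Set (Fin n)} (hU : U ⊆ U') (S : Finset (Fin n)) :
    IsNonnegOfDegreeLE (S.card - 1) (setConv (G.nonemptyIndepWeight PowerSeries.X U') h S -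
      setConv (G.nonemptyIndepWeight PowerSeries.X U) h S) := by
  classical
  induction hm : S.card generalizing S U U' with
  | zero =>
    rw [Finset.card_eq_zero.1 hm, setConv_nonemptyIndepWeight_empty,
      setConv_nonemptyIndepWeight_empty, sub_zero]
    exact .zero
  | succ m ih =>
    -- It suffices to add the elements of `U'` to `U` one at a time.
    have step : ∀ (U : Set (Fin n)) (v : Fin n),
        IsNonnegOfDegreeLE m (setConv (G.nonemptyIndepWeight PowerSeries.X (insert v U)) h S -
          setConv (G.nonemptyIndepWeight PowerSeries.X U) h S) := by
      intro U v
      by_cases hv : v ∈ U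
      · rw [Set.insert_eq_of_mem hv, sub_self]
        exact .zero
      by_cases hS : v ∈ S
      · have hc : (S.erase v).card = m := by rw [Finset.card_erase_of_mem hS]; omega
        rw [setConv_nonemptyIndepWeight_insert G _ hh hv hS]
        have h1 := ih (Set.subset_univ (U \ G.neighborSet v)) (S.erase v) hc
        have h2 := ih (Set.empty_subset (U \ G.neighborSet v)) (S.erase v) hc
        rw [nonemptyIndepWeight_empty_left, zero_setConv, Pi.zero_apply, sub_zero] at h2
        refine .add (.add ?_ ?_) (h2.mono (by omega))
        · rw [setOne]
          split_ifs
          · exact .one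
          · exact .zero
        · rcases Nat.eq_zero_or_pos m with hm0 | hm0
          · rw [hm0, Finset.card_eq_zero] at hc
            rw [hc, setConv_nonemptyIndepWeight_empty, setConv_nonemptyIndepWeight_empty, sub_zero,
              mul_zero]
            exact .zero
          · exact (IsNonnegOfDegreeLE.X.mul h1).mono (by omega)
      · rw [setConv_nonemptyIndepWeight_insert_of_notMem G _ _ _ hS, sub_self]
        exact .zero
    have all : ∀ D : Finset (Fin n),
        IsNonnegOfDegreeLE m (setConv (G.nonemptyIndepWeight PowerSeries.X (U ∪ D)) h S -
          setConv (G.nonemptyIndepWeight PowerSeries.X U) h S) := by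
      intro D
      induction D using Finset.induction_on with
      | empty =>
        rw [Finset.coe_empty, Set.union_empty, sub_self]
        exact .zero
      | insert a D _ ihD =>
        rw [Finset.coe_insert, Set.union_insert]
        simpa only [sub_add_sub_cancel] using (step (U ∪ D) a).add ihD
    have := all U'.toFinset
    rwa [Set.coe_toFinset, Set.union_eq_self_of_subset_left hU] at this

theorem setConv_defectSum {A : Type*} [CommRing A] (t : A) (h : Finset (Fin n) → A)
    (S : Finset (Fin n)) :
    setConv h (G.defectSum t) S = ∑ b ∈ S, ∑ c ∈ S.erase b, open Classical in
      if b ∈ G.upperNonNeighbors c then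
        ∑ T ∈ ((S.erase b).erase c).powerset,
          (setConv (G.nonemptyIndepWeight t (G.upperNonNeighbors b)) h T -
            setConv (G.nonemptyIndepWeight t (G.upperNonNeighbors b \ G.neighborSet c)) h T) *
          G.continuationSum t c (((S.erase b).erase c) \ T) else 0 := by
  classical
  rw [defectSum, setConv_sumErase, sumErase]
  refine Finset.sum_congr rfl fun b _ => ?_
  rw [setConv_sumErase, sumErase]
  refine Finset.sum_congr rfl fun c _ => ?_
  split_ifs
  · rw [← setConv_assoc, setConv_comm h, sub_setConv]
    rfl
  · rw [setConv_zero, Pi.zero_apply]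

theorem defectTerm_isNonneg {h : Finset (Fin n) → PowerSeries ℤ}
    (hh : h = setOne + (PowerSeries.X : PowerSeries ℤ) •
      setConv (G.nonemptyIndepWeight PowerSeries.X Set.univ) h)
    (b c : Fin n) {S T : Finset (Fin n)} (hT : T ⊆ S) :
    IsNonnegOfDegreeLE (S.card - 1)
      ((setConv (G.nonemptyIndepWeight PowerSeries.X (G.upperNonNeighbors b)) h T -
        setConv (G.nonemptyIndepWeight PowerSeries.X
          (G.upperNonNeighbors b \ G.neighborSet c)) h T) *
      G.continuationSum PowerSeries.X c (S \ T)) := by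
  have hcard := Finset.card_sdiff_add_card_eq_card hT
  rcases T.eq_empty_or_nonempty with rfl | hne
  · rw [setConv_nonemptyIndepWeight_empty, setConv_nonemptyIndepWeight_empty, sub_zero, zero_mul]
    exact .zero
  · have := hne.card_pos
    exact ((G.setConv_nonemptyIndepWeight_mono hh Set.sdiff_subset T).mul
      (G.continuationSum_isNonneg c _)).mono (by omega)

open Classical in
theorem defectSummand_isNonneg {h : Finset (Fin n) → PowerSeries ℤ}
    (hh : h = setOne + (PowerSeries.X : PowerSeries ℤ) •
      setConv (G.nonemptyIndepWeight PowerSeries.X Set.univ) h)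
    {b c : Fin n} {S : Finset (Fin n)} (hb : b ∈ S) (hc : c ∈ S.erase b) :
    IsNonnegOfDegreeLE (S.card - 3) (if b ∈ G.upperNonNeighbors c then
      ∑ T ∈ ((S.erase b).erase c).powerset,
        (setConv (G.nonemptyIndepWeight PowerSeries.X (G.upperNonNeighbors b)) h T -
          setConv (G.nonemptyIndepWeight PowerSeries.X
            (G.upperNonNeighbors b \ G.neighborSet c)) h T) *
        G.continuationSum PowerSeries.X c (((S.erase b).erase c) \ T) else 0) := by
  split_ifs
  · refine .sum fun T hT => (G.defectTerm_isNonneg hh b c (Finset.mem_powerset.1 hT)).mono ?_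
    rw [Finset.card_erase_of_mem hc, Finset.card_erase_of_mem hb]
    omega
  · exact .zero

theorem setConv_defectSum_isNonneg {h : Finset (Fin n) → PowerSeries ℤ}
    (hh : h = setOne + (PowerSeries.X : PowerSeries ℤ) •
      setConv (G.nonemptyIndepWeight PowerSeries.X Set.univ) h) (S : Finset (Fin n)) :
    IsNonnegOfDegreeLE (S.card - 3) (setConv h (G.defectSum PowerSeries.X) S) := by
  rw [setConv_defectSum]
  exact .sum fun b hb => .sum fun c hc => G.defectSummand_isNonneg hh hb hc

open Classical in
theorem setConv_nonemptyIndepWeight_singleton {A : Type*} [CommRing A] (t : A) (U : Set (Fin n))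
    {h : Finset (Fin n) → A} (h0 : h ∅ = 1) (r : Fin n) :
    setConv (G.nonemptyIndepWeight t U) h {r} = if r ∈ U then 1 else 0 := by
  rw [setConv, Finset.sum_eq_single {r}]
  · rw [Finset.sdiff_self, h0, mul_one, nonemptyIndepWeight]
    simp
  · intro T hT hne
    rw [(Finset.subset_singleton_iff.1 (Finset.mem_powerset.1 hT)).resolve_right hne]
    simp [nonemptyIndepWeight]
  · simp

theorem setConv_defectSum_eq_zero_iff {h : Finset (Fin n) → PowerSeries ℤ}
    (hh : h = setOne + (PowerSeries.X : PowerSeries ℤ) •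
      setConv (G.nonemptyIndepWeight PowerSeries.X Set.univ) h) :
    setConv h (G.defectSum PowerSeries.X) Finset.univ = 0 ↔ G.singleLongEdgeTriples = ∅ := by
  classical
  have h0 : h ∅ = 1 := by
    rw [hh, Pi.add_apply, Pi.smul_apply, setConv_nonemptyIndepWeight_empty]
    simp [setOne]
  rw [setConv_defectSum]
  constructor
  · intro hz
    rw [Set.eq_empty_iff_forall_notMem]
    rintro _ ⟨c, b, r, hcb, hbr, -, h1, h2, h3⟩
    revert hz
    have hcm : c ∈ Finset.univ.erase b := by simp [hcb.ne]
    have hsum : ∀ b ∈ Finset.univ, _ := fun (b : Fin n) hb =>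
      IsNonnegOfDegreeLE.sum fun c hc => G.defectSummand_isNonneg hh (b := b) (c := c) hb hc
    refine IsNonnegOfDegreeLE.sum_ne_zero hsum (Finset.mem_univ b) ?_
    refine IsNonnegOfDegreeLE.sum_ne_zero
      (fun c hc => G.defectSummand_isNonneg hh (Finset.mem_univ b) hc) hcm ?_
    rw [if_pos (G.mem_upperNonNeighbors.2 ⟨hcb.le, fun h => h2 h.symm⟩)]
    -- The triple `c < b < r` contributes to the summand of `b`, `c` through the set `{r}`.
    have hr : {r} ∈ ((Finset.univ.erase b).erase c).powerset := by
      simp [(hcb.trans hbr).ne', hbr.ne']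
    refine IsNonnegOfDegreeLE.sum_ne_zero
      (fun T hT => G.defectTerm_isNonneg hh b c (Finset.mem_powerset.1 hT)) hr ?_
    refine mul_ne_zero ?_ (G.continuationSum_ne_zero _ _)
    rw [setConv_nonemptyIndepWeight_singleton _ _ _ h0,
      setConv_nonemptyIndepWeight_singleton _ _ _ h0,
      if_pos (G.mem_upperNonNeighbors.2 ⟨hbr.le, fun h => h3 h.symm⟩),
      if_neg fun h => h.2 h1, sub_zero]
    exact one_ne_zero
  · intro hW
    refine Finset.sum_eq_zero fun b _ => Finset.sum_eq_zero fun c hc => ?_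
    split_ifs with hbc
    · have : G.upperNonNeighbors b \ G.neighborSet c = G.upperNonNeighbors b := by
        refine sdiff_eq_left.2 (Set.disjoint_left.2 fun r hr hrc => ?_)
        rw [mem_upperNonNeighbors] at hr hbc
        have hbr : b ≠ r := fun h => hbc.2 (h ▸ (show G.Adj c r from hrc).symm)
        have hbc' : c ≠ b := Finset.ne_of_mem_erase hc
        exact Set.eq_empty_iff_forall_notMem.1 hW _ ⟨c, b, r, lt_of_le_of_ne hbc.1 hbc',
          lt_of_le_of_ne hr.1 hbr, rfl, hrc, fun h => hbc.2 h.symm, fun h => hr.2 h.symm⟩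
      rw [this]
      simp
    · rfl

end Nonneg

/-! ### Proper colourings and the recursion they satisfy -/

section Colorings

variable {n : ℕ} (G : SimpleGraph (Fin n))

/-- The proper colourings of the subgraph induced by `S` with colours `0, …, k - 1`, extended
by `0` outside `S`. -/
def colorings (S : Finset (Fin n)) (k : ℕ) : Finset (Fin n → ℕ) :=
  @Finset.filter _ (fun f => ∀ u ∈ S, ∀ v ∈ S, G.Adj u v → f u ≠ f v) (Classical.decPred _)
    (Fintype.piFinset fun v => if v ∈ S then Finset.range k else {0})

theorem mem_colorings {S : Finset (Fin n)} {k : ℕ} {f : Fin n → ℕ} :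
    f ∈ G.colorings S k ↔ (∀ v ∈ S, f v < k) ∧ (∀ v ∉ S, f v = 0) ∧
      ∀ u ∈ S, ∀ v ∈ S, G.Adj u v → f u ≠ f v := by
  rw [colorings, @Finset.mem_filter _ _ (Classical.decPred _), Fintype.mem_piFinset, ← and_assoc]
  refine and_congr_left fun _ => ⟨fun h => ⟨fun v hv => ?_, fun v hv => ?_⟩, fun h v => ?_⟩
  · simpa [hv] using h v
  · simpa [hv] using h v
  · by_cases hv : v ∈ S
    · simpa [hv] using h.1 v hv
    · simpa [hv] using h.2 v hv

theorem card_colorings_univ (k : ℕ) :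
    (G.colorings Finset.univ k).card = Nat.card (G.Coloring (Fin k)) := by
  rw [← Nat.card_eq_finsetCard]
  refine Nat.card_congr
    { toFun := fun f => Coloring.mk
        (fun v => ⟨f.1 v, (G.mem_colorings.1 f.2).1 v (Finset.mem_univ v)⟩) fun {u v} huv h =>
          (G.mem_colorings.1 f.2).2.2 u (Finset.mem_univ u) v (Finset.mem_univ v) huv
            (congrArg Fin.val h)
      invFun := fun c => ⟨fun v => c v, G.mem_colorings.2 ⟨fun v _ => (c v).2,
        fun v hv => absurd (Finset.mem_univ v) hv,
        fun u _ v _ huv h => c.valid huv (Fin.ext h)⟩⟩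
      left_inv := fun f => rfl
      right_inv := fun c => by ext v; rfl }

theorem card_colorings_zero (S : Finset (Fin n)) :
    (G.colorings S 0).card = if S = ∅ then 1 else 0 := by
  split_ifs with h
  · subst h
    rw [Finset.card_eq_one]
    refine ⟨0, Finset.ext fun f => ?_⟩
    rw [mem_colorings, Finset.mem_singleton, funext_iff]
    simp
  · rw [Finset.card_eq_zero, Finset.eq_empty_iff_forall_notMem]
    intro f hf
    obtain ⟨v, hv⟩ := Finset.nonempty_iff_ne_empty.2 h
    exact absurd ((G.mem_colorings.1 hf).1 v hv) (Nat.not_lt_zero _)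

open Classical in
/-- Removing the class `T` of the last colour. -/
theorem card_colorings_succ (S : Finset (Fin n)) (k : ℕ) :
    (G.colorings S (k + 1)).card =
      ∑ T ∈ S.powerset, if G.IsIndepSet (T : Set (Fin n)) then (G.colorings (S \ T) k).card
        else 0 := by
  rw [Finset.card_eq_sum_card_fiberwise (f := fun f => S.filter fun v => f v = k) (t := S.powerset)
    fun f _ => Finset.mem_coe.2 (Finset.mem_powerset.2 (Finset.filter_subset _ _))]
  refine Finset.sum_congr rfl fun T hT => ?_
  have hTS := Finset.mem_powerset.1 hT
  split_ifs with hI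
  · refine Finset.card_bij' (fun f _ v => if v ∈ T then 0 else f v)
      (fun f _ v => if v ∈ T then k else f v) ?_ ?_ ?_ ?_
    · intro f hf
      obtain ⟨hf, hfT⟩ := Finset.mem_filter.1 hf
      obtain ⟨h1, h2, h3⟩ := G.mem_colorings.1 hf
      rw [Finset.ext_iff] at hfT
      simp only [Finset.mem_filter] at hfT
      refine G.mem_colorings.2 ⟨fun v hv => ?_, fun v hv => ?_, fun u hu v hv => ?_⟩
      · obtain ⟨hv, hvT⟩ := Finset.mem_sdiff.1 hv
        have := h1 v hv
        have h4 : f v ≠ k := fun h => hvT ((hfT v).1 ⟨hv, h⟩)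
        rw [if_neg hvT]
        omega
      · by_cases hvT : v ∈ T
        · rw [if_pos hvT]
        · rw [if_neg hvT]
          exact h2 v fun h => hv (Finset.mem_sdiff.2 ⟨h, hvT⟩)
      · rw [Finset.mem_sdiff] at hu hv
        rw [if_neg hu.2, if_neg hv.2]
        exact h3 u hu.1 v hv.1
    · intro f hf
      obtain ⟨h1, h2, h3⟩ := G.mem_colorings.1 hf
      have h4 : ∀ v ∈ S, v ∉ T → f v < k := fun v hv hvT =>
        h1 v (Finset.mem_sdiff.2 ⟨hv, hvT⟩)
      refine Finset.mem_filter.2 ⟨G.mem_colorings.2 ⟨fun v hv => ?_, fun v hv => ?_,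
        fun u hu v hv huv => ?_⟩, Finset.ext fun v => ?_⟩
      · split_ifs with hvT
        · exact k.lt_succ_self
        · exact (h4 v hv hvT).trans k.lt_succ_self
      · rw [if_neg fun h => hv (hTS h)]
        exact h2 v fun h => hv (Finset.mem_sdiff.1 h).1
      · split_ifs with huT hvT hvT
        · exact fun _ => hI huT hvT huv.ne huv
        · exact (h4 v hv hvT).ne'
        · exact (h4 u hu huT).ne
        · exact h3 u (Finset.mem_sdiff.2 ⟨hu, huT⟩) v (Finset.mem_sdiff.2 ⟨hv, hvT⟩) huv
      · rw [Finset.mem_filter]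
        refine ⟨fun ⟨hv, h⟩ => ?_, fun hv => ⟨hTS hv, if_pos hv⟩⟩
        by_contra hvT
        exact (h4 v hv hvT).ne ((if_neg hvT).symm.trans h)
    · intro f hf
      obtain ⟨-, hfT⟩ := Finset.mem_filter.1 hf
      funext v
      by_cases hvT : v ∈ T
      · refine (if_pos hvT).trans ?_
        rw [← hfT] at hvT
        exact (Finset.mem_filter.1 hvT).2.symm
      · exact (if_neg hvT).trans (if_neg hvT)
    · intro f hf
      funext v
      by_cases hvT : v ∈ T
      · refine (if_pos hvT).trans ?_
        exact ((G.mem_colorings.1 hf).2.1 v fun h => (Finset.mem_sdiff.1 h).2 hvT).symm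
      · exact (if_neg hvT).trans (if_neg hvT)
  · rw [Finset.card_eq_zero, Finset.eq_empty_iff_forall_notMem]
    intro f hf
    obtain ⟨hf, hfT⟩ := Finset.mem_filter.1 hf
    refine hI fun u hu v hv _ huv => ?_
    rw [← hfT] at hu hv
    obtain ⟨hu, hu'⟩ := Finset.mem_filter.1 (Finset.mem_coe.1 hu)
    obtain ⟨hv, hv'⟩ := Finset.mem_filter.1 (Finset.mem_coe.1 hv)
    exact (G.mem_colorings.1 hf).2.2 u hu v hv huv (hu'.trans hv'.symm)

/-- The generating function of the numbers of proper colourings of the subgraph induced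
by `S`. -/
def coloringSeries (S : Finset (Fin n)) : PowerSeries ℤ :=
  PowerSeries.mk fun k => ((G.colorings S k).card : ℤ)

/-- The numerator of `coloringSeries` over the denominator `(1 - t) ^ (|S| + 1)`. -/
def coloringNumerator (S : Finset (Fin n)) : PowerSeries ℤ :=
  (1 - PowerSeries.X) ^ (S.card + 1) * G.coloringSeries S

open Classical in
/-- Removing the class of the last colour, which may be empty. -/
theorem coloringSeries_eq (S : Finset (Fin n)) :
    G.coloringSeries S = setOne S + PowerSeries.X *
      ∑ T ∈ S.powerset, if G.IsIndepSet (T : Set (Fin n)) then G.coloringSeries (S \ T) else 0 := by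
  ext k
  rw [map_add]
  have h1 : (setOne S : PowerSeries ℤ) = PowerSeries.C (if S = ∅ then 1 else 0) := by
    rw [setOne]
    split_ifs <;> simp
  cases k with
  | zero =>
    rw [PowerSeries.coeff_zero_X_mul, add_zero, h1, PowerSeries.coeff_zero_C, coloringSeries,
      PowerSeries.coeff_mk, card_colorings_zero]
    split_ifs <;> simp
  | succ k =>
    rw [PowerSeries.coeff_succ_X_mul, h1, PowerSeries.coeff_C, if_neg k.succ_ne_zero, zero_add,
      coloringSeries, PowerSeries.coeff_mk, card_colorings_succ, map_sum, Nat.cast_sum]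
    refine Finset.sum_congr rfl fun T _ => ?_
    split_ifs
    · rw [coloringSeries, PowerSeries.coeff_mk]
    · simp

/-- In terms of the numerators only nonempty classes remain: the empty class is absorbed by one
factor `1 - t`. -/
theorem coloringNumerator_eq :
    G.coloringNumerator = setOne + (PowerSeries.X : PowerSeries ℤ) •
      setConv (G.nonemptyIndepWeight PowerSeries.X Set.univ) G.coloringNumerator := by
  classical
  funext S
  have h1 := G.coloringSeries_eq S
  rw [← Finset.add_sum_erase _ _ (Finset.empty_mem_powerset S), if_pos (by simp),
    Finset.sdiff_empty, mul_add, add_left_comm] at h1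
  have h2 : (1 - PowerSeries.X) ^ S.card * (setOne S : PowerSeries ℤ) = setOne S := by
    rw [setOne]
    split_ifs with h
    · simp [h]
    · simp
  have h3 : (1 - PowerSeries.X) ^ S.card * ∑ T ∈ S.powerset.erase ∅,
      (if G.IsIndepSet (T : Set (Fin n)) then G.coloringSeries (S \ T) else 0) =
      setConv (G.nonemptyIndepWeight PowerSeries.X Set.univ) G.coloringNumerator S := by
    rw [setConv, ← Finset.add_sum_erase _ _ (Finset.empty_mem_powerset S), Finset.mul_sum]
    have h0 : G.nonemptyIndepWeight (PowerSeries.X : PowerSeries ℤ) Set.univ ∅ = 0 := by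
      simp [nonemptyIndepWeight]
    rw [h0, zero_mul, zero_add]
    refine Finset.sum_congr rfl fun T hT => ?_
    obtain ⟨hne, hTS⟩ := Finset.mem_erase.1 hT
    have hc := Finset.card_sdiff_add_card_eq_card (Finset.mem_powerset.1 hTS)
    have hpos := (Finset.nonempty_iff_ne_empty.2 hne).card_pos
    have hexp : S.card = (T.card - 1) + ((S \ T).card + 1) := by omega
    by_cases hI : G.IsIndepSet (T : Set (Fin n))
    · rw [if_pos hI, nonemptyIndepWeight, if_pos ⟨hne, hI, Set.subset_univ _⟩, coloringNumerator,
        hexp, pow_add, mul_assoc]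
    · rw [if_neg hI, nonemptyIndepWeight, if_neg fun h => hI h.2.1, mul_zero, zero_mul]
  rw [Pi.add_apply, Pi.smul_apply, smul_eq_mul, ← h3, coloringNumerator]
  conv_rhs => rw [← h2]
  rw [pow_succ]
  linear_combination (1 - PowerSeries.X) ^ S.card * h1

end Colorings

/-! ### Orderings as permutations -/

section Orderings

variable {n : ℕ} {A : Type*} [CommRing A] (t : A) (G : SimpleGraph (Fin n))

open Classical in
theorem wordSum_eq_sum_injective (m : ℕ) (c : Fin n) (S : Finset (Fin n)) :
    G.wordSum t m c S = ∑ f : Fin m → Fin n,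
      if Function.Injective f ∧ ∀ i, f i ∈ S then
        t ^ ∑ i : Fin m, G.orderDelta (Fin.cons (α := fun _ => Fin n) c f i.castSucc) (f i)
      else 0 := by
  induction m generalizing c S with
  | zero =>
    rw [wordSum, Fintype.sum_unique, if_pos ⟨Function.injective_of_subsingleton _, fun i => i.elim0⟩]
    simp
  | succ m ih =>
    rw [wordSum, ← (Fin.consEquiv fun _ => Fin n).sum_comp, Fintype.sum_prod_type,
      ← Finset.sum_subset (Finset.subset_univ S)]
    · refine Finset.sum_congr rfl fun x hx => ?_
      rw [ih, Finset.mul_sum]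
      refine Finset.sum_congr rfl fun g _ => ?_
      have key : (Function.Injective (Fin.consEquiv (fun _ => Fin n) (x, g)) ∧
          ∀ i, Fin.consEquiv (fun _ => Fin n) (x, g) i ∈ S) ↔
          Function.Injective g ∧ ∀ i, g i ∈ S.erase x := by
        rw [show Fin.consEquiv (fun _ => Fin n) (x, g) = Fin.cons x g from rfl,
          Fin.cons_injective_iff]
        simp only [ Fin.forall_fin_succ, Fin.cons_zero,
          Fin.cons_succ, Finset.mem_erase, hx, true_and, Set.mem_range, not_exists, forall_and]
        tauto
      rw [if_congr key rfl rfl, mul_ite, mul_zero]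
      congr 1
      rw [Fin.sum_univ_succ, pow_add]
      rfl
    · intro x _ hx
      refine Finset.sum_eq_zero fun g _ => if_neg fun h => hx ?_
      simpa using h.2 0

theorem orderingSum_univ_eq (hn : 0 < n) :
    G.orderingSum t Finset.univ = ∑ π : Equiv.Perm (Fin n), t ^ (1 + G.orderingDelta π) := by
  classical
  obtain ⟨m, rfl⟩ := Nat.exists_eq_succ_of_ne_zero hn.ne'
  have h0 : setOne (Finset.univ : Finset (Fin (m + 1))) = (0 : A) :=
    if_neg Finset.univ_nonempty.ne_empty
  rw [orderingSum, Pi.add_apply, Pi.smul_apply, h0, zero_add, smul_eq_mul]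
  simp only [pow_add, pow_one, ← Finset.mul_sum]
  congr 1
  have h1 : ∑ π : Equiv.Perm (Fin (m + 1)), t ^ G.orderingDelta π =
      ∑ f : Fin (m + 1) → Fin (m + 1), if Function.Injective f then
        t ^ ∑ i : Fin m, G.orderDelta (f i.castSucc) (f i.succ) else 0 := by
    rw [← Finset.sum_filter]
    refine Finset.sum_nbij (fun π => π) ?_ ?_ ?_ ?_
    · intro π _
      exact Finset.mem_filter.2 ⟨Finset.mem_univ _, π.injective⟩
    · intro π _ π' _ h
      exact DFunLike.coe_injective h
    · intro f hf
      have hf := (Finset.mem_filter.1 (Finset.mem_coe.1 hf)).2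
      exact ⟨Equiv.ofBijective f (Finite.injective_iff_bijective.1 hf), by simp, rfl⟩
    · intro π _
      rfl
  rw [h1, ← (Fin.consEquiv fun _ => Fin (m + 1)).sum_comp, Fintype.sum_prod_type, sumErase]
  refine Finset.sum_congr rfl fun x _ => ?_
  have hc : (Finset.univ.erase x).card = m := by
    rw [Finset.card_erase_of_mem (Finset.mem_univ x), Finset.card_univ, Fintype.card_fin,
      Nat.succ_eq_add_one, Nat.add_sub_cancel]
  rw [continuationSum, hc, wordSum_eq_sum_injective]
  refine Finset.sum_congr rfl fun g _ => if_congr ?_ rfl rfl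
  rw [show Fin.consEquiv (fun _ => Fin (m + 1)) (x, g) = Fin.cons x g from rfl,
    Fin.cons_injective_iff]
  simp only [Set.mem_range, not_exists, Finset.mem_erase, Finset.mem_univ, and_true]
  exact and_comm

end Orderings

/-! ### Passage to polynomials in one variable -/

section Evaluation

variable {n : ℕ} (G : SimpleGraph (Fin n))

theorem eval_neg_choose_X_add (k i m : ℕ) (hi : i + 1 ≤ k + m) :
    eval (-(k : ℚ)) (Ring.choose (X + (i : ℚ[X])) m) =
      (-1) ^ m * ((k + m - 1 - i).choose m : ℕ) := by
  have h1 : -(k : ℚ) + i = -((k : ℚ) - i) := by ring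
  have h2 : (k : ℚ) - i + m - 1 = ((k + m - 1 - i : ℕ) : ℚ) := by
    rw [Nat.sub_sub, Nat.cast_sub (by omega)]
    push_cast
    ring
  rw [← coe_evalRingHom, Ring.map_choose, map_add, map_natCast, coe_evalRingHom, eval_X, h1,
    Ring.choose_neg, h2, Ring.choose_natCast, Units.smul_def, zsmul_eq_mul, Int.negOnePow_def]
  simp

/-- The truncated subtraction is harmless: if `k < j`, then `k + m - j < m` and the binomial
coefficient vanishes. -/
theorem coeff_X_pow_mul_mk_choose (m j k : ℕ) (hj : j ≤ m) :
    PowerSeries.coeff k ((PowerSeries.X : PowerSeries ℤ) ^ j *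
      PowerSeries.mk fun i => ((m + i).choose m : ℤ)) = ((k + m - j).choose m : ℕ) := by
  rw [PowerSeries.coeff_X_pow_mul']
  split_ifs with h
  · rw [PowerSeries.coeff_mk]
    congr 2
    omega
  · rw [Nat.choose_eq_zero_of_lt (by omega), Nat.cast_zero]

theorem orderingDelta_lt (hn : 0 < n) (π : Equiv.Perm (Fin n)) : G.orderingDelta π < n := by
  have : G.orderingDelta π ≤ ∑ _i : Fin (n - 1), 1 := Finset.sum_le_sum fun i _ => by
    rcases G.orderDelta_eq_zero_or_one (π ⟨(i : ℕ), by omega⟩) (π ⟨(i : ℕ) + 1, by omega⟩)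
      with h | h <;> omega
  simp at this
  omega

/-- The coefficients of the identity `orderingSum_sub`, divided by `(1 - t) ^ (n + 1)`. -/
theorem sum_choose_sub_card_coloring (hn : 3 ≤ n) (k : ℕ) :
    ∑ π : Equiv.Perm (Fin n), ((k + n - 1 - G.orderingDelta π).choose n : ℤ) -
      Nat.card (G.Coloring (Fin k)) =
    ∑ i ∈ Finset.range (n - 2),
      PowerSeries.coeff i (setConv G.coloringNumerator (G.defectSum PowerSeries.X) Finset.univ) *
        ((k + (n - 2) - 1 - i).choose (n - 2) : ℕ) := by
  set Q := setConv G.coloringNumerator (G.defectSum PowerSeries.X) Finset.univ with hQ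
  have hdeg := G.setConv_defectSum_isNonneg G.coloringNumerator_eq Finset.univ
  rw [← hQ, Finset.card_univ, Fintype.card_fin] at hdeg
  -- `Q` is the polynomial with the coefficients on the right-hand side.
  have hQsum : Q = ∑ i ∈ Finset.range (n - 2),
      PowerSeries.C (PowerSeries.coeff i Q) * PowerSeries.X ^ i := by
    ext j
    simp only [map_sum, PowerSeries.coeff_C_mul, PowerSeries.coeff_X_pow, mul_ite, mul_one,
      mul_zero, Finset.sum_ite_eq, Finset.mem_range]
    split_ifs with hj
    · rfl
    · exact (hdeg j).2 (by omega)
  have hmain := congrFun (G.orderingSum_sub (PowerSeries.X : PowerSeries ℤ) _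
    G.coloringNumerator_eq) Finset.univ
  rw [Pi.sub_apply, Pi.smul_apply, smul_eq_mul, ← hQ, orderingSum_univ_eq _ _ (by omega),
    coloringNumerator, Finset.card_univ, Fintype.card_fin] at hmain
  have hinv : ∀ d : ℕ, (PowerSeries.mk fun i => ((d + i).choose d : ℤ)) *
      (1 - PowerSeries.X) ^ (d + 1) = 1 :=
    fun d => PowerSeries.mk_add_choose_mul_one_sub_pow_eq_one ℤ d
  set I := PowerSeries.mk fun i => ((n + i).choose n : ℤ) with hI
  set J := PowerSeries.mk fun i => ((n - 2 + i).choose (n - 2) : ℤ) with hJ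
  have hIJ : I * (1 - PowerSeries.X) ^ 2 = J := by
    have h1 := hinv n
    have h2 := hinv (n - 2)
    have h3 : (1 - PowerSeries.X : PowerSeries ℤ) ^ (n + 1) =
      (1 - PowerSeries.X) ^ 2 * (1 - PowerSeries.X) ^ (n - 2 + 1) := by
      rw [← pow_add]
      congr 1
      omega
    rw [← hI, h3] at h1
    rw [← hJ] at h2
    linear_combination J * h1 - I * (1 - PowerSeries.X) ^ 2 * h2
  have hser : ∑ π : Equiv.Perm (Fin n), PowerSeries.X ^ (1 + G.orderingDelta π) * I -
      G.coloringSeries Finset.univ =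
      ∑ i ∈ Finset.range (n - 2), PowerSeries.C (PowerSeries.coeff i Q) *
        (PowerSeries.X ^ (i + 1) * J) := by
    have h1 : ∑ i ∈ Finset.range (n - 2), PowerSeries.C (PowerSeries.coeff i Q) *
        (PowerSeries.X ^ (i + 1) * J) = PowerSeries.X * Q * J := by
      conv_rhs => rw [hQsum]
      rw [Finset.mul_sum, Finset.sum_mul]
      refine Finset.sum_congr rfl fun i _ => ?_
      ring
    rw [h1, ← Finset.sum_mul, ← hIJ]
    linear_combination I * hmain + G.coloringSeries Finset.univ * hinv n
  have hk := congrArg (PowerSeries.coeff k) hser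
  rw [map_sub, map_sum, map_sum, coloringSeries, PowerSeries.coeff_mk, card_colorings_univ] at hk
  convert hk using 2
  · refine Finset.sum_congr rfl fun π _ => ?_
    have := G.orderingDelta_lt (by omega) π
    rw [hI, coeff_X_pow_mul_mk_choose _ _ _ (by omega)]
    congr 2
    omega
  · rename_i i hi
    have := Finset.mem_range.1 hi
    rw [PowerSeries.coeff_C_mul, hJ, coeff_X_pow_mul_mk_choose _ _ _ (by omega)]
    congr 3
    omega

end Evaluation

end SimpleGraph

end

theorem mainTheorem3 (n : ℕ) (hn : 3 ≤ n) (G : SimpleGraph (Fin n)) :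
    ∃ d : ℕ → ℕ,
      G.psiPolynomial =
        (-1 : ℚ[X]) ^ n * G.chromaticPolynomial.comp (-X) +
          ∑ i ∈ Finset.range (n - 2), (d i : ℚ[X]) * Ring.choose (X + (i : ℚ[X])) (n - 2) ∧
      ((∀ i ∈ Finset.range (n - 2), d i = 0) ↔ G.singleLongEdgeTriples = ∅) := by
  have hdeg := G.setConv_defectSum_isNonneg G.coloringNumerator_eq Finset.univ
  have hzero := G.setConv_defectSum_eq_zero_iff G.coloringNumerator_eq
  have hcount := G.sum_choose_sub_card_coloring hn
  set Q := SimpleGraph.setConv G.coloringNumerator (G.defectSum PowerSeries.X) Finset.univ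
  rw [Finset.card_univ, Fintype.card_fin] at hdeg
  have hcast : ∀ i, (((PowerSeries.coeff i Q).toNat : ℕ) : ℤ) = PowerSeries.coeff i Q :=
    fun i => Int.toNat_of_nonneg (hdeg i).1
  refine ⟨fun i => (PowerSeries.coeff i Q).toNat, ?_, ?_⟩
  · -- Compare the values at the negative integers.
    refine Polynomial.eq_of_infinite_eval_eq _ _ (Set.Infinite.mono ?_
      (Set.infinite_range_of_injective
        (f := fun k : ℕ => -((k + 1 : ℕ) : ℚ)) fun a b h => by simpa using h))
    rintro _ ⟨k, rfl⟩
    have hk : ∑ π : Equiv.Perm (Fin n), ((k + 1 + n - 1 - G.orderingDelta π).choose n : ℤ) -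
        Nat.card (G.Coloring (Fin (k + 1))) = ∑ i ∈ Finset.range (n - 2),
          (((PowerSeries.coeff i Q).toNat : ℕ) : ℤ) *
            ((k + 1 + (n - 2) - 1 - i).choose (n - 2) : ℕ) := by
      rw [hcount]
      exact Finset.sum_congr rfl fun i _ => by rw [hcast]
    replace hk := congrArg (Int.cast : ℤ → ℚ) hk
    push_cast at hk
    have h1 : (G.psiPolynomial).eval (-((k + 1 : ℕ) : ℚ)) = (-1) ^ n *
        ∑ π : Equiv.Perm (Fin n), ((k + 1 + n - 1 - G.orderingDelta π).choose n : ℚ) := by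
      rw [SimpleGraph.psiPolynomial, eval_finsetSum, Finset.mul_sum]
      refine Finset.sum_congr rfl fun π _ => ?_
      have := G.orderingDelta_lt (by omega) π
      exact SimpleGraph.eval_neg_choose_X_add _ _ _ (by omega)
    have h2 : (-1 : ℚ) ^ (n - 2) = (-1) ^ n := by
      conv_rhs => rw [show n = n - 2 + 2 by omega, pow_add]
      norm_num
    have h3 : (∑ i ∈ Finset.range (n - 2), (((PowerSeries.coeff i Q).toNat : ℕ) : ℚ[X]) *
        Ring.choose (X + (i : ℚ[X])) (n - 2)).eval (-((k + 1 : ℕ) : ℚ)) =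
        (-1) ^ n * ∑ i ∈ Finset.range (n - 2), (((PowerSeries.coeff i Q).toNat : ℕ) : ℚ) *
          ((k + 1 + (n - 2) - 1 - i).choose (n - 2) : ℕ) := by
      rw [eval_finsetSum, Finset.mul_sum]
      refine Finset.sum_congr rfl fun i hi => ?_
      have := Finset.mem_range.1 hi
      rw [eval_mul, eval_natCast, SimpleGraph.eval_neg_choose_X_add _ _ _ (by omega), h2]
      ring
    show G.psiPolynomial.eval (-((k + 1 : ℕ) : ℚ)) = eval (-((k + 1 : ℕ) : ℚ)) _
    rw [eval_add, eval_mul, eval_pow, eval_neg, eval_one, eval_comp, eval_neg, eval_X, neg_neg,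
      G.chromaticPolynomial_eval _ k.succ_pos, h3, h1, ← hk]
    ring
  · rw [← hzero]
    constructor
    · intro h
      ext i
      rw [map_zero, ← hcast]
      by_cases hi : i ∈ Finset.range (n - 2)
      · exact_mod_cast h i hi
      · rw [hcast]
        rw [Finset.mem_range] at hi
        exact (hdeg i).2 (by omega)
    · intro h i _
      simp [h]
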